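/- For a metric probability space $(M,d,\mu)$ (with $\mu$ a Borel probability measure), let the subgaussian constant $\sigma^2(\mu)\in[0,\infty]$ be the infimum of all $\sigma^2\ge 0$ such that $$\int_M e^{tf}\,d\mu\le e^{\sigma^2t^2/2}\qquad\text{for all } t\in\mathbb R$$ and for every $\mu$-integrable $f:M\to\mathbb R$ with $\int_M f\,d\mu=0$ and $|f(x)-f(y)|\le d(x,y)$ for all $x,y\in M$. There is an absolute constant $c>0$ such that the following holds for every integer $n\ge2$ and every $\varepsilon\in[0,1]$. Let $\nu$ be the uniform distribution on the spherical shell $$A_\varepsilon=\{x\in\mathbb R^n:\ 1-\varepsilon\le|x|\le1\}$$ (where $|\cdot|$ is the Euclidean norm), that is, the normalized Lebesgue measure on $A_\varepsilon$ if $\varepsilon>0$, and the normalized surface measure on the unit sphere $A_0=S^{n-1}$ if $\varepsilon=0$. Then the subgaussian constant of $\nu$, on $A_\varepsilon$ with the Euclidean distance, satisfies $$\sigma^2(\nu)\le\frac{c}{n}.$$ -/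

import Mathlib

open MeasureTheory ProbabilityTheory Set

open scoped NNReal ENNReal

noncomputable section

/-- The subgaussian constant `σ²(μ)` of a metric probability space `(M, d, μ)`: the infimum
(in `[0, ∞]`, so that it is `∞` when no finite value is admissible) over all `s ≥ 0` such that
`∫ exp (t f) dμ ≤ exp (s t² / 2)` for all real `t` and for every `f : M → ℝ` of `μ`-mean zero with
Lipschitz seminorm at most `1` with respect to the distance of `M`. -/
def subgaussianConst {M : Type*} [MetricSpace M] [MeasurableSpace M] (μ : Measure M) : ℝ≥0∞ :=
  ⨅ (s : ℝ≥0) (_ : ∀ f : M → ℝ, LipschitzWith 1 f → Integrable f μ → ∫ x, f x ∂μ = 0 →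
    HasSubgaussianMGF f s μ), (s : ℝ≥0∞)

/-- The spherical shell `{x ∈ ℝⁿ : 1 - ε ≤ |x| ≤ 1}`, where `|x|` is the Euclidean norm. -/
def shell (n : ℕ) (ε : ℝ) : Set (EuclideanSpace ℝ (Fin n)) :=
  {x | 1 - ε ≤ ‖x‖ ∧ ‖x‖ ≤ 1}

/-- The uniform distribution on the shell, as a measure on `ℝⁿ`: the normalized Lebesgue measure
on the shell if `ε ≠ 0`, and, if `ε = 0`, when the shell is the unit sphere, the normalized surface
measure of the unit sphere. -/
def uniformShell (n : ℕ) (ε : ℝ) : Measure (EuclideanSpace ℝ (Fin n)) :=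
  if ε = 0 then
    (ProbabilityTheory.cond (volume : Measure (EuclideanSpace ℝ (Fin n))).toSphere univ).map Subtype.val
  else ProbabilityTheory.cond volume (shell n ε)

/-- The uniform distribution regarded as a measure on the shell itself, which as a subtype of `ℝⁿ`
carries the Euclidean distance. -/
def shellMeasure (n : ℕ) (ε : ℝ) : Measure (shell n ε) :=
  (uniformShell n ε).comap Subtype.val

end

/-! A uniform point of the shell is `R • θ`, with `θ` uniform on the sphere and `R` independent of
`θ`. The radius has density proportional to `r ^ (n - 1)` on `[1 - ε, 1]`, or is `1` when `ε = 0`.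
Integration by parts gives `E exp (a (1 - R)) ≤ exp ((2a + 2a²) / n)` uniformly in `ε`. A
1-Lipschitz `F` satisfies `|F (R θ) - F θ| ≤ 1 - R`, so concentration on the sphere at scale `1 / n`
bounds the moment generating function by the exponential of a multiple of `(|t| + t²) / n`
(`integral_exp_radial_le`). For `|t| ≥ 1` the linear term is absorbed; for `|t| ≤ 1` centering
removes it (`integral_exp_mul_le_of_integral_eq_zero`).

Concentration on the sphere (`integral_exp_unifSphere_le`) comes from Gaussian space. The
Maurey–Pisier rotation argument shows that centered Lipschitz functions of a Gaussian vector `X` are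
subgaussian without dependence on dimension. It is applied to the 1-homogeneous extension of `f`,
whose value at `X` is `‖X‖ * f θ` with independent factors; Jensen replaces `‖X‖` by its mean, which
is at least a constant times `√n`. -/

lemma norm_rotate_sub_le {E : Type*} [NormedAddCommGroup E] [NormedSpace ℝ E] (θ : ℝ) (x y : E) :
    ‖Real.cos θ • x + Real.sin θ • y - x‖ ≤ |θ| * (‖x‖ + ‖y‖) := by
  have h1 : |Real.cos θ - 1| ≤ |θ| := by
    have := Real.abs_cos_sub_cos_le θ 0
    simpa using this
  have h2 : |Real.sin θ| ≤ |θ| := Real.abs_sin_le_abs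
  calc ‖Real.cos θ • x + Real.sin θ • y - x‖ = ‖(Real.cos θ - 1) • x + Real.sin θ • y‖ := by
        congr 1; module
    _ ≤ |Real.cos θ - 1| * ‖x‖ + |Real.sin θ| * ‖y‖ := by
        refine (norm_add_le _ _).trans ?_
        rw [norm_smul, norm_smul, Real.norm_eq_abs, Real.norm_eq_abs]
    _ ≤ |θ| * ‖x‖ + |θ| * ‖y‖ := by gcongr
    _ = _ := by ring

/-! ### The standard Gaussian measure: density and exponential moments. -/

section StdGaussian

variable {E : Type*} [NormedAddCommGroup E] [InnerProductSpace ℝ E] [FiniteDimensional ℝ E]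
  [MeasurableSpace E] [BorelSpace E]

/-- The standard Gaussian measure has a finite exponential moment of the norm of every order. -/
lemma integrable_exp_mul_norm_stdGaussian (a : ℝ) :
    Integrable (fun x : E ↦ Real.exp (a * ‖x‖)) (stdGaussian E) := by
  obtain ⟨C, hC, h⟩ := IsGaussian.exists_integrable_exp_sq (stdGaussian E)
  refine (h.const_mul (Real.exp (a ^ 2 / (4 * C)))).mono' (by fun_prop)
    (Filter.Eventually.of_forall fun x ↦ ?_)
  rw [Real.norm_eq_abs, Real.abs_exp, ← Real.exp_add, Real.exp_le_exp]
  have : a ^ 2 / (4 * C) + C * ‖x‖ ^ 2 - a * ‖x‖ = (a - 2 * C * ‖x‖) ^ 2 / (4 * C) := by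
    field_simp; ring
  have h2 : 0 ≤ (a - 2 * C * ‖x‖) ^ 2 / (4 * C) := by positivity
  linarith

/-- The standard Gaussian measure has a density with respect to the Lebesgue measure which is a
function of the norm. -/
lemma stdGaussian_eq_withDensity :
    stdGaussian E = (volume : Measure E).withDensity (fun x ↦
      ENNReal.ofReal ((2 * Real.pi) ^ (-(Module.finrank ℝ E / 2 : ℝ)) *
        Real.exp (-(1 / 2) * ‖x‖ ^ 2))) := by
  set c : ℝ := (2 * Real.pi) ^ (-(Module.finrank ℝ E / 2 : ℝ)) with hc
  have hc0 : 0 < c := by positivity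
  have hint : Integrable (fun x : E ↦ Real.exp (-(1 / 2) * ‖x‖ ^ 2)) := by
    have := (GaussianFourier.integrable_cexp_neg_mul_sq_norm_add (V := E) (b := ((1 / 2 : ℝ) : ℂ))
      (by simp) 0 0).norm
    refine this.congr (Filter.Eventually.of_forall fun x ↦ ?_)
    simp [Complex.norm_exp, ← Complex.ofReal_pow]
  have hfin : IsFiniteMeasure ((volume : Measure E).withDensity (fun x ↦
      ENNReal.ofReal (c * Real.exp (-(1 / 2) * ‖x‖ ^ 2)))) :=
    isFiniteMeasure_withDensity_ofReal (hint.const_mul c).2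
  -- Both measures are finite, so it suffices to compare Fourier transforms.
  refine Measure.ext_of_charFun (funext fun t ↦ ?_)
  rw [charFun_stdGaussian, charFun_apply, integral_withDensity_eq_integral_toReal_smul (by fun_prop)
    (Filter.Eventually.of_forall fun x ↦ ENNReal.ofReal_lt_top)]
  have h := GaussianFourier.integral_cexp_neg_mul_sq_norm_add (V := E) (b := ((1 / 2 : ℝ) : ℂ))
      (by simp) Complex.I t
  have h2 : ∀ x : E, (ENNReal.ofReal (c * Real.exp (-(1 / 2) * ‖x‖ ^ 2))).toReal •
      Complex.exp (inner ℝ x t * Complex.I) = (c : ℂ) *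
        Complex.exp (-((1 / 2 : ℝ) : ℂ) * ‖x‖ ^ 2 + Complex.I * inner ℝ t x) := by
    intro x
    rw [ENNReal.toReal_ofReal (by positivity), Complex.real_smul, Complex.exp_add,
      real_inner_comm x t]
    push_cast
    ring_nf
  simp_rw [h2]
  rw [integral_const_mul, h]
  have h3 : (Real.pi / ((1 / 2 : ℝ) : ℂ)) ^ (Module.finrank ℝ E / 2 : ℂ) =
      (((2 * Real.pi) ^ (Module.finrank ℝ E / 2 : ℝ) : ℝ) : ℂ) := by
    rw [Complex.ofReal_cpow (by positivity)]
    push_cast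
    congr 1
    ring
  rw [h3, ← mul_assoc, ← Complex.ofReal_mul, hc, ← Real.rpow_add (by positivity)]
  simp only [neg_add_cancel, Real.rpow_zero, Complex.ofReal_one, one_mul, Complex.I_sq]
  congr 1
  push_cast
  ring

/-- Lets Rademacher's theorem, an almost everywhere statement for Lebesgue measure, be used under
the Gaussian. -/
lemma stdGaussian_absolutelyContinuous : stdGaussian E ≪ (volume : Measure E) := by
  rw [stdGaussian_eq_withDensity]
  exact withDensity_absolutelyContinuous _ _

/-- The moment generating function of a linear form under the standard Gaussian measure. -/
lemma integral_exp_strongDual_stdGaussian (L : StrongDual ℝ E) (t : ℝ) :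
    ∫ x, Real.exp (t * L x) ∂(stdGaussian E) = Real.exp (t ^ 2 * ‖L‖ ^ 2 / 2) := by
  have h := mgf_gaussianReal (IsGaussian.map_eq_gaussianReal (μ := stdGaussian E) L) t
  rw [integral_strongDual_stdGaussian, variance_dual_stdGaussian, mgf] at h
  rw [h, Real.coe_toNNReal _ (by positivity)]
  ring_nf

end StdGaussian

/-! ### Gaussian concentration by rotation. -/

section MaureyPisier

open Filter Topology

variable {E : Type*} [NormedAddCommGroup E] [InnerProductSpace ℝ E] [FiniteDimensional ℝ E]
  [MeasurableSpace E] [BorelSpace E]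

lemma integrable_exp_mul_norm_add_norm_stdGaussian (a : ℝ) :
    Integrable (fun p : E × E ↦ Real.exp (a * (‖p.1‖ + ‖p.2‖)))
      ((stdGaussian E).prod (stdGaussian E)) := by
  refine ((integrable_exp_mul_norm_stdGaussian (E := E) a).mul_prod
    (integrable_exp_mul_norm_stdGaussian (E := E) a)).congr (Eventually.of_forall fun p ↦ ?_)
  simp only [← Real.exp_add, mul_add]

lemma integrable_exp_of_le_norm_add_norm {g : E × E → ℝ} (hg : Continuous g) (a : ℝ)
    (h : ∀ p, g p ≤ a * (‖p.1‖ + ‖p.2‖)) :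
    Integrable (fun p ↦ Real.exp (g p)) ((stdGaussian E).prod (stdGaussian E)) := by
  refine (integrable_exp_mul_norm_add_norm_stdGaussian a).mono'
    (by fun_prop) (Eventually.of_forall fun p ↦ ?_)
  rw [Real.norm_eq_abs, Real.abs_exp, Real.exp_le_exp]
  exact h p

/-- Linearity in `|θ|` is the point: at angle `π / (2N)`, after multiplication by `N`, the bound
does not depend on `N`, which supplies the dominating function below. -/
lemma LipschitzWith.abs_rotate_sub_le {E : Type*} [NormedAddCommGroup E] [NormedSpace ℝ E]
    {F : E → ℝ} {L : ℝ≥0} (hF : LipschitzWith L F) (θ : ℝ) (p : E × E) :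
    |F (Real.cos θ • p.1 + Real.sin θ • p.2) - F p.1| ≤ L * (|θ| * (‖p.1‖ + ‖p.2‖)) := by
  have := hF.dist_le_mul (Real.cos θ • p.1 + Real.sin θ • p.2) p.1
  rw [Real.dist_eq, dist_eq_norm] at this
  exact this.trans (by gcongr; exact norm_rotate_sub_le _ _ _)

/-- Subdividing the quarter turn from `X` to `Y` into `N` steps and using convexity of `exp`
together with the rotation invariance of the Gaussian measure. -/
lemma integral_exp_sub_le_integral_exp_rotate {F : E → ℝ} {L : ℝ≥0} (hF : LipschitzWith L F)
    (t : ℝ) {N : ℕ} (hN : 0 < N) :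
    ∫ p, Real.exp (t * (F p.2 - F p.1)) ∂((stdGaussian E).prod (stdGaussian E)) ≤
      ∫ p, Real.exp (t * (N * (F (Real.cos (Real.pi / 2 / N) • p.1 +
        Real.sin (Real.pi / 2 / N) • p.2) - F p.1))) ∂((stdGaussian E).prod (stdGaussian E)) := by
  set γ := (stdGaussian E).prod (stdGaussian E) with hγ
  set h : ℝ := Real.pi / 2 / N with hh
  have hN' : (0 : ℝ) < N := by exact_mod_cast hN
  have hFc : Continuous F := hF.continuous
  set G : E × E → ℝ := fun p ↦ F (Real.cos h • p.1 + Real.sin h • p.2) - F p.1 with hG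
  have hGc : Continuous G := by fun_prop
  have hGint : Integrable (fun p ↦ Real.exp (t * (N * G p))) γ := by
    refine integrable_exp_of_le_norm_add_norm (by fun_prop) (|t| * N * L * |h|) fun p ↦ ?_
    calc t * (N * G p) ≤ |t * (N * G p)| := le_abs_self _
      _ = |t| * N * |G p| := by rw [abs_mul, abs_mul, abs_of_pos hN', mul_assoc]
      _ ≤ |t| * N * (L * (|h| * (‖p.1‖ + ‖p.2‖))) := by
        gcongr
        exact hF.abs_rotate_sub_le h p
      _ = _ := by ring
  -- `G ∘ R k` is the `k`-th increment of `F` along the arc from `p.1` to `p.2`; by rotation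
  -- invariance all these increments have the law of `G`.
  set R : ℕ → E × E → E × E := fun k ↦ ContinuousLinearMap.rotation ((k : ℝ) * h) with hR
  have hRmp : ∀ k, MeasurePreserving (R k) γ γ := fun k ↦
    ⟨by fun_prop, IsGaussian.map_rotation_eq_self (by simp) _⟩
  have hGR : ∀ k p, G (R k p) = F (Real.cos ((k + 1 : ℕ) * h) • p.1 +
      Real.sin ((k + 1 : ℕ) * h) • p.2) -
      F (Real.cos (k * h) • p.1 + Real.sin (k * h) • p.2) := by
    intro k p
    simp only [hG, hR, ContinuousLinearMap.rotation_apply]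
    congr 2
    push_cast
    rw [add_mul, one_mul, Real.cos_add, Real.sin_add]
    module
  have hsum : ∀ p, F p.2 - F p.1 = ∑ k ∈ Finset.range N, G (R k p) := by
    intro p
    simp_rw [hGR]
    rw [Finset.sum_range_sub (fun k : ℕ ↦ F (Real.cos (k * h) • p.1 + Real.sin (k * h) • p.2)) N]
    have : (N : ℝ) * h = Real.pi / 2 := by rw [hh]; field_simp
    simp [this]
  have hint : ∀ k, Integrable (fun p ↦ Real.exp (t * (N * G (R k p)))) γ := fun k ↦
    (hRmp k).integrable_comp_of_integrable hGint
  have hpt : ∀ p, Real.exp (t * (F p.2 - F p.1)) ≤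
      ∑ k ∈ Finset.range N, (N : ℝ)⁻¹ * Real.exp (t * (N * G (R k p))) := by
    intro p
    -- Jensen with `N` equal weights, hence the factor `N` inside the exponential.
    have := convexOn_exp.map_sum_le (t := Finset.range N) (w := fun _ ↦ (N : ℝ)⁻¹)
      (p := fun k ↦ t * (N * G (R k p))) (fun _ _ ↦ by positivity)
      (by simp [hN'.ne']) (fun _ _ ↦ mem_univ _)
    simp only [smul_eq_mul] at this
    refine le_trans (le_of_eq ?_) this
    rw [hsum, Finset.mul_sum]
    congr 1
    refine Finset.sum_congr rfl fun k _ ↦ ?_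
    field_simp
  calc ∫ p, Real.exp (t * (F p.2 - F p.1)) ∂γ
      ≤ ∫ p, ∑ k ∈ Finset.range N, (N : ℝ)⁻¹ * Real.exp (t * (N * G (R k p))) ∂γ := by
        refine integral_mono_of_nonneg (Eventually.of_forall fun p ↦ (Real.exp_pos _).le) ?_
          (Eventually.of_forall hpt)
        exact integrable_finsetSum _ fun k _ ↦ (hint k).const_mul _
    _ = ∑ k ∈ Finset.range N, (N : ℝ)⁻¹ * ∫ p, Real.exp (t * (N * G p)) ∂γ := by
        rw [integral_finsetSum _ fun k _ ↦ (hint k).const_mul _]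
        refine Finset.sum_congr rfl fun k _ ↦ ?_
        rw [integral_const_mul]
        congr 1
        have hm : AEStronglyMeasurable (fun p ↦ Real.exp (t * (N * G p))) (γ.map (R k)) := by
          fun_prop
        rw [← integral_map (hRmp k).measurable.aemeasurable hm, (hRmp k).map_eq]
    _ = _ := by
        rw [Finset.sum_const, Finset.card_range, nsmul_eq_mul, ← mul_assoc,
          mul_inv_cancel₀ hN'.ne', one_mul]

/-- The arc leaves `x` with velocity `y`, so `N` times the first increment tends to `π / 2` times
the derivative in direction `y`. -/
lemma DifferentiableAt.tendsto_rotate {E : Type*} [NormedAddCommGroup E] [NormedSpace ℝ E]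
    {F : E → ℝ} {x : E} (hF : DifferentiableAt ℝ F x) (y : E) :
    Tendsto (fun N : ℕ ↦ (N : ℝ) * (F (Real.cos (Real.pi / 2 / N) • x +
        Real.sin (Real.pi / 2 / N) • y) - F x)) atTop (𝓝 (Real.pi / 2 * fderiv ℝ F x y)) := by
  have hφ : HasDerivAt (fun θ : ℝ ↦ Real.cos θ • x + Real.sin θ • y) y 0 := by
    exact (((Real.hasDerivAt_cos 0).smul_const x).add
      ((Real.hasDerivAt_sin 0).smul_const y)).congr_deriv (by simp)
  have hF' : HasFDerivAt F (fderiv ℝ F x) (Real.cos 0 • x + Real.sin 0 • y) := by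
    simpa using hF.hasFDerivAt
  have hd := (hF'.comp_hasDerivAt (0 : ℝ) hφ).tendsto_slope_zero_right
  have hlim : Tendsto (fun N : ℕ ↦ Real.pi / 2 / (N : ℝ)) atTop (𝓝[>] 0) := by
    refine tendsto_nhdsWithin_iff.2 ⟨tendsto_const_div_atTop_nhds_zero_nat _, ?_⟩
    filter_upwards [eventually_gt_atTop 0] with N hN
    have : (0 : ℝ) < N := by exact_mod_cast hN
    exact mem_Ioi.2 (by positivity)
  refine ((hd.comp hlim).const_mul (Real.pi / 2)).congr' ?_
  filter_upwards [eventually_gt_atTop 0] with N hN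
  have : (0 : ℝ) < N := by exact_mod_cast hN
  simp only [Function.comp_apply, zero_add, Real.cos_zero, Real.sin_zero, one_smul, zero_smul,
    add_zero, smul_eq_mul]
  field_simp

/-- **Gaussian concentration** (Maurey–Pisier): a two-point exponential inequality for Lipschitz
functions of a standard Gaussian vector. -/
theorem LipschitzWith.integral_exp_sub_stdGaussian_le {F : E → ℝ} {L : ℝ≥0}
    (hF : LipschitzWith L F) (t : ℝ) :
    ∫ p, Real.exp (t * (F p.2 - F p.1)) ∂((stdGaussian E).prod (stdGaussian E)) ≤
      Real.exp (Real.pi ^ 2 * L ^ 2 * t ^ 2 / 8) := by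
  set γ := (stdGaussian E).prod (stdGaussian E) with hγ
  have hFc : Continuous F := hF.continuous
  set Φ : ℕ → E × E → ℝ := fun N p ↦ Real.exp (t * (N * (F (Real.cos (Real.pi / 2 / N) • p.1 +
        Real.sin (Real.pi / 2 / N) • p.2) - F p.1))) with hΦ
  set Ψ : E × E → ℝ := fun p ↦ Real.exp (t * (Real.pi / 2 * fderiv ℝ F p.1 p.2)) with hΨ
  set B : E × E → ℝ := fun p ↦ Real.exp ((|t| * L * (Real.pi / 2)) * (‖p.1‖ + ‖p.2‖)) with hB
  have hBint : Integrable B γ := integrable_exp_mul_norm_add_norm_stdGaussian _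
  have hΦm : ∀ N, AEStronglyMeasurable (Φ N) γ := fun N ↦
    Continuous.aestronglyMeasurable (by fun_prop)
  have hΦB : ∀ N, ∀ p, ‖Φ N p‖ ≤ B p := by
    intro N p
    rw [Real.norm_eq_abs, Real.abs_exp, Real.exp_le_exp]
    have h1 := hF.abs_rotate_sub_le (Real.pi / 2 / N) p
    set D := F (Real.cos (Real.pi / 2 / N) • p.1 + Real.sin (Real.pi / 2 / N) • p.2) - F p.1
    have hθ : (N : ℝ) * |Real.pi / 2 / N| ≤ Real.pi / 2 := by
      rcases Nat.eq_zero_or_pos N with rfl | hN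
      · simp only [CharP.cast_eq_zero, zero_mul]
        positivity
      · have : (0 : ℝ) < N := by exact_mod_cast hN
        rw [abs_of_pos (by positivity)]
        field_simp
        rfl
    calc t * (N * D) ≤ |t * (N * D)| := le_abs_self _
      _ = |t| * (N * |D|) := by rw [abs_mul, abs_mul, Nat.abs_cast]
      _ ≤ |t| * (N * (L * (|Real.pi / 2 / N| * (‖p.1‖ + ‖p.2‖)))) := by gcongr
      _ = |t| * L * (N * |Real.pi / 2 / N|) * (‖p.1‖ + ‖p.2‖) := by ring
      _ ≤ |t| * L * (Real.pi / 2) * (‖p.1‖ + ‖p.2‖) := by gcongr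
  have hdiff : ∀ᵐ p ∂γ, DifferentiableAt ℝ F p.1 := by
    have h1 : ∀ᵐ x ∂(stdGaussian E), DifferentiableAt ℝ F x :=
      stdGaussian_absolutelyContinuous.ae_le (hF.ae_differentiableAt (μ := volume))
    exact Measure.quasiMeasurePreserving_fst.ae h1
  have hlim : ∀ᵐ p ∂γ, Tendsto (fun N ↦ Φ N p) atTop (𝓝 (Ψ p)) := by
    filter_upwards [hdiff] with p hp
    exact (Real.continuous_exp.tendsto _).comp ((hp.tendsto_rotate p.2).const_mul t)
  have hDCT := tendsto_integral_of_dominated_convergence B hΦm hBint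
    (fun N ↦ Eventually.of_forall (hΦB N)) hlim
  have hΨm : AEStronglyMeasurable Ψ γ := aestronglyMeasurable_of_tendsto_ae atTop hΦm hlim
  have hΨint : Integrable Ψ γ := by
    refine hBint.mono' hΨm ?_
    filter_upwards [hlim] with p hp
    exact le_of_tendsto hp.norm (Eventually.of_forall fun N ↦ hΦB N p)
  have hΨle : ∫ p, Ψ p ∂γ ≤ Real.exp (Real.pi ^ 2 * L ^ 2 * t ^ 2 / 8) := by
    rw [hγ, integral_prod _ hΨint]
    -- For fixed `x` the exponent is a linear form in the independent Gaussian `y`, of norm at most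
    -- `|t| L π / 2`.
    have hx : ∀ x : E, ∫ y, Ψ (x, y) ∂(stdGaussian E) ≤
        Real.exp (Real.pi ^ 2 * L ^ 2 * t ^ 2 / 8) := by
      intro x
      have := integral_exp_strongDual_stdGaussian (fderiv ℝ F x) (t * (Real.pi / 2))
      simp only [hΨ, ← mul_assoc]
      rw [this, Real.exp_le_exp]
      have hn : ‖fderiv ℝ F x‖ ≤ L := norm_fderiv_le_of_lipschitz ℝ hF
      calc (t * (Real.pi / 2)) ^ 2 * ‖fderiv ℝ F x‖ ^ 2 / 2
          ≤ (t * (Real.pi / 2)) ^ 2 * L ^ 2 / 2 := by gcongr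
        _ = _ := by ring
    refine (integral_mono_of_nonneg (Eventually.of_forall fun x ↦
      integral_nonneg fun y ↦ (Real.exp_pos _).le) (integrable_const _)
      (Eventually.of_forall hx)).trans ?_
    simp
  refine le_trans (ge_of_tendsto hDCT ?_) hΨle
  filter_upwards [eventually_gt_atTop 0] with N hN
  exact integral_exp_sub_le_integral_exp_rotate hF t hN

end MaureyPisier

/-! ### Polar decomposition of radial measures. -/

section Polar

open Metric

variable {E : Type*} [NormedAddCommGroup E] [InnerProductSpace ℝ E] [FiniteDimensional ℝ E]
  [MeasurableSpace E] [BorelSpace E]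

lemma toSphere_univ_ne_zero [Nontrivial E] : (volume : Measure E).toSphere univ ≠ 0 :=
  Measure.measure_univ_ne_zero.2 (Measure.toSphere_ne_zero _)

variable (E) in
/-- The normalized surface measure of the unit sphere. -/
noncomputable def unifSphere : Measure (sphere (0 : E) 1) :=
  ProbabilityTheory.cond (volume : Measure E).toSphere univ

instance [Nontrivial E] : IsProbabilityMeasure (unifSphere E) :=
  cond_isProbabilityMeasure toSphere_univ_ne_zero

lemma lintegral_unifSphere (f : sphere (0 : E) 1 → ℝ≥0∞) :
    ∫⁻ θ, f θ ∂(unifSphere E) =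
      ((volume : Measure E).toSphere univ)⁻¹ * ∫⁻ θ, f θ ∂(volume : Measure E).toSphere := by
  rw [unifSphere, ProbabilityTheory.cond, Measure.restrict_univ, lintegral_smul_measure,
    smul_eq_mul]

/-- Integration in polar coordinates. -/
lemma lintegral_eq_lintegral_toSphere [Nontrivial E] {h : E → ℝ≥0∞} (hh : Measurable h) :
    ∫⁻ x, h x = ∫⁻ θ, ∫⁻ r, h ((r : ℝ) • (θ : E))
      ∂(Measure.volumeIoiPow (Module.finrank ℝ E - 1)) ∂(volume : Measure E).toSphere := by
  have hmp := (volume : Measure E).measurePreserving_homeomorphUnitSphereProd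
  have hf : Measurable (fun p : sphere (0 : E) 1 × Ioi (0 : ℝ) ↦ h ((p.2 : ℝ) • (p.1 : E))) := by
    fun_prop
  rw [← lintegral_prod _ hf.aemeasurable, ← hmp.lintegral_comp hf]
  have h1 : ∀ x : ({0}ᶜ : Set E), h (((homeomorphUnitSphereProd E x).2 : ℝ) •
      ((homeomorphUnitSphereProd E x).1 : E)) = h x := by
    intro x
    have hx : ‖(x : E)‖ ≠ 0 := norm_ne_zero_iff.2 x.2
    simp [smul_smul, hx]
  simp_rw [h1]
  rw [lintegral_subtype_comap (measurableSet_singleton _).compl]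
  rw [restrict_compl_singleton]

/-- A probability measure with a radial density is the law of `R • θ` with `θ` uniform on the
sphere and `R` independent of `θ`. -/
theorem eq_map_smul_of_withDensity_norm [Nontrivial E] {P : Measure E} [IsProbabilityMeasure P]
    {w : ℝ → ℝ≥0∞} (hw : Measurable w)
    (hP : P = (volume : Measure E).withDensity (fun x ↦ w ‖x‖)) :
    P = ((unifSphere E).prod (P.map norm)).map (fun p ↦ p.2 • (p.1 : E)) := by
  set S : ℝ≥0∞ := (volume : Measure E).toSphere univ with hS
  have hS0 : S ≠ 0 := toSphere_univ_ne_zero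
  have hST : S ≠ ∞ := measure_ne_top _ _
  set κ := Measure.volumeIoiPow (Module.finrank ℝ E - 1) with hκ
  have key : ∀ h : E → ℝ≥0∞, Measurable h → ∫⁻ x, h x ∂P =
      ∫⁻ θ, ∫⁻ r, w r * h ((r : ℝ) • (θ : E)) ∂κ ∂(volume : Measure E).toSphere := by
    intro h hh
    rw [hP, lintegral_withDensity_eq_lintegral_mul _ (by fun_prop) hh,
      lintegral_eq_lintegral_toSphere (by fun_prop)]
    refine lintegral_congr fun θ ↦ lintegral_congr fun r ↦ ?_
    simp [norm_smul, abs_of_pos (mem_Ioi.1 r.2)]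
  -- For radial integrands the sphere contributes only its mass `S`, so the law of the norm has
  -- density `S * w` against `κ`; this `S` cancels the normalization of `unifSphere`.
  have key2 : ∀ g : ℝ → ℝ≥0∞, Measurable g → ∫⁻ r, g r ∂(P.map norm) =
      S * ∫⁻ r, w r * g r ∂κ := by
    intro g hg
    rw [lintegral_map hg measurable_norm, key _ (by fun_prop), mul_comm, hS, ← lintegral_const]
    refine lintegral_congr fun θ ↦ lintegral_congr fun r ↦ ?_
    simp [norm_smul, abs_of_pos (mem_Ioi.1 r.2)]
  refine Measure.ext_of_lintegral _ fun h hh ↦ ?_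
  have : IsProbabilityMeasure (P.map norm) :=
    Measure.isProbabilityMeasure_map measurable_norm.aemeasurable
  rw [lintegral_map hh (by fun_prop), lintegral_prod _ (by fun_prop), lintegral_unifSphere,
    key h hh, ← hS]
  have : ∀ θ : sphere (0 : E) 1, ∫⁻ r, h (r • (θ : E)) ∂(P.map norm) =
      S * ∫⁻ r, w r * h ((r : ℝ) • (θ : E)) ∂κ := fun θ ↦ key2 _ (by fun_prop)
  simp_rw [this]
  rw [lintegral_const_mul' _ _ hST, ← mul_assoc, ENNReal.inv_mul_cancel hS0 hST, one_mul]

end Polar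

/-! ### Jensen's inequality and centered functions of bounded oscillation. -/

section Centering

lemma exp_integral_le_integral_exp {Ω : Type*} [MeasurableSpace Ω] {μ : Measure Ω}
    [IsProbabilityMeasure μ] {g : Ω → ℝ} (hg : Integrable g μ)
    (hexp : Integrable (fun ω ↦ Real.exp (g ω)) μ) :
    Real.exp (∫ ω, g ω ∂μ) ≤ ∫ ω, Real.exp (g ω) ∂μ :=
  convexOn_exp.map_integral_le Real.continuous_exp.continuousOn isClosed_univ
    (Filter.Eventually.of_forall fun _ ↦ mem_univ _) hg hexp

lemma abs_le_of_integral_eq_zero {Ω : Type*} [MeasurableSpace Ω] {μ : Measure Ω}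
    [IsProbabilityMeasure μ] {g : Ω → ℝ} {D : ℝ} (hg : Integrable g μ) (h0 : ∫ ω, g ω ∂μ = 0)
    (hD : ∀ x y, |g x - g y| ≤ D) (x : Ω) : |g x| ≤ D := by
  have h1 : g x = ∫ y, (g x - g y) ∂μ := by
    rw [integral_sub (integrable_const _) hg, h0]; simp
  rw [h1, ← Real.norm_eq_abs]
  refine (norm_integral_le_of_norm_le_const (C := D)
    (Filter.Eventually.of_forall fun y ↦ hD x y)).trans ?_
  simp

end Centering

/-! ### Homogeneous extension from the sphere. -/

section Homogeneous

variable {E : Type*} [NormedAddCommGroup E] [NormedSpace ℝ E]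

/-- The positively `1`-homogeneous extension of the restriction of `f` to the unit sphere. -/
noncomputable def homogeneousExtension (f : E → ℝ) (x : E) : ℝ := ‖x‖ * f (‖x‖⁻¹ • x)

lemma homogeneousExtension_smul (f : E → ℝ) {r : ℝ} (hr : 0 ≤ r) {θ : E} (hθ : ‖θ‖ = 1) :
    homogeneousExtension f (r • θ) = r * f θ := by
  rcases hr.eq_or_lt with rfl | hr
  · simp [homogeneousExtension]
  · simp [homogeneousExtension, norm_smul, hθ, abs_of_pos hr, smul_smul, hr.ne']

lemma norm_inv_norm_smul {x : E} (hx : x ≠ 0) : ‖(‖x‖⁻¹ • x)‖ = 1 := by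
  simp [norm_smul, norm_ne_zero_iff.2 hx]

lemma norm_mul_norm_normalize_sub_le {x y : E} (hx : x ≠ 0) (hy : y ≠ 0) :
    ‖y‖ * ‖‖x‖⁻¹ • x - ‖y‖⁻¹ • y‖ ≤ 2 * ‖x - y‖ := by
  have hx' : ‖x‖ ≠ 0 := norm_ne_zero_iff.2 hx
  have hy' : ‖y‖ ≠ 0 := norm_ne_zero_iff.2 hy
  have h1 : ‖y‖ • (‖x‖⁻¹ • x - ‖y‖⁻¹ • y) = (‖y‖ - ‖x‖) • (‖x‖⁻¹ • x) + (x - y) := by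
    rw [smul_sub, sub_smul, smul_inv_smul₀ hx', smul_inv_smul₀ hy']
    abel
  calc ‖y‖ * ‖‖x‖⁻¹ • x - ‖y‖⁻¹ • y‖ = ‖(‖y‖ - ‖x‖) • (‖x‖⁻¹ • x) + (x - y)‖ := by
        rw [← h1, norm_smul, norm_norm]
    _ ≤ |‖y‖ - ‖x‖| * 1 + ‖x - y‖ := by
        refine (norm_add_le _ _).trans ?_
        rw [norm_smul, norm_inv_norm_smul hx, Real.norm_eq_abs]
    _ ≤ ‖x - y‖ * 1 + ‖x - y‖ := by
        gcongr
        rw [norm_sub_rev x y]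
        exact abs_norm_sub_norm_le y x
    _ = 2 * ‖x - y‖ := by ring

/-- The change of radius costs `2 * ‖x - y‖`, by the bound on `f`; the change of direction, weighted
by `‖y‖`, costs another `2 * ‖x - y‖`. -/
lemma lipschitzWith_homogeneousExtension {f : E → ℝ} (hf : LipschitzWith 1 f)
    (hb : ∀ x, ‖x‖ = 1 → |f x| ≤ 2) : LipschitzWith 4 (homogeneousExtension f) := by
  have hz : ∀ x, |homogeneousExtension f x| ≤ 2 * ‖x‖ := by
    intro x
    rcases eq_or_ne x 0 with rfl | hx
    · simp [homogeneousExtension]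
    · rw [homogeneousExtension, abs_mul, abs_norm, mul_comm]
      gcongr
      exact hb _ (norm_inv_norm_smul hx)
  have h0 : homogeneousExtension f 0 = 0 := by simp [homogeneousExtension]
  refine LipschitzWith.of_dist_le_mul fun x y ↦ ?_
  rw [Real.dist_eq, dist_eq_norm]
  change _ ≤ 4 * ‖x - y‖
  rcases eq_or_ne x 0 with rfl | hx
  · rw [h0, zero_sub, abs_neg, zero_sub, norm_neg]
    linarith [hz y, norm_nonneg y]
  rcases eq_or_ne y 0 with rfl | hy
  · rw [h0, sub_zero, sub_zero]
    linarith [hz x, norm_nonneg x]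
  have h1 : homogeneousExtension f x - homogeneousExtension f y =
      (‖x‖ - ‖y‖) * f (‖x‖⁻¹ • x) + ‖y‖ * (f (‖x‖⁻¹ • x) - f (‖y‖⁻¹ • y)) := by
    simp only [homogeneousExtension]; ring
  have h2 : |f (‖x‖⁻¹ • x) - f (‖y‖⁻¹ • y)| ≤ ‖‖x‖⁻¹ • x - ‖y‖⁻¹ • y‖ := by
    have := hf.dist_le_mul (‖x‖⁻¹ • x) (‖y‖⁻¹ • y)
    simpa [Real.dist_eq, dist_eq_norm] using this
  calc |homogeneousExtension f x - homogeneousExtension f y|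
      ≤ |‖x‖ - ‖y‖| * |f (‖x‖⁻¹ • x)| + ‖y‖ * |f (‖x‖⁻¹ • x) - f (‖y‖⁻¹ • y)| := by
        rw [h1]
        refine (abs_add_le _ _).trans ?_
        rw [abs_mul, abs_mul, abs_norm]
    _ ≤ ‖x - y‖ * 2 + ‖y‖ * ‖‖x‖⁻¹ • x - ‖y‖⁻¹ • y‖ := by
        gcongr
        · exact abs_norm_sub_norm_le x y
        · exact hb _ (norm_inv_norm_smul hx)
    _ ≤ ‖x - y‖ * 2 + 2 * ‖x - y‖ :=
        add_le_add_right (norm_mul_norm_normalize_sub_le hx hy) _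
    _ = 4 * ‖x - y‖ := by ring

end Homogeneous

/-! ### Lower bound for the mean Gaussian norm. -/

section GaussianNorm

variable {E : Type*} [NormedAddCommGroup E] [InnerProductSpace ℝ E] [FiniteDimensional ℝ E]
  [MeasurableSpace E] [BorelSpace E]

/-- The first absolute moment of the standard Gaussian distribution on the line. -/
noncomputable def gaussianAbsMoment : ℝ := ∫ x, |x| ∂(gaussianReal 0 1)

lemma gaussianAbsMoment_pos : 0 < gaussianAbsMoment := by
  have hint : Integrable (fun x : ℝ ↦ |x|) (gaussianReal 0 1) :=
    (IsGaussian.integrable_id (μ := gaussianReal 0 1)).abs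
  rw [gaussianAbsMoment, integral_pos_iff_support_of_nonneg (fun x ↦ abs_nonneg x) hint]
  have : Function.support (fun x : ℝ ↦ |x|) = {0}ᶜ := by ext; simp
  rw [this, measure_compl (measurableSet_singleton _) (measure_ne_top _ _)]
  have : NullSingletonClass (gaussianReal 0 1) := nullSingletonClass_gaussianReal one_ne_zero
  simp

/-- By Cauchy–Schwarz the `ℓ¹` norm of the coordinates is at most `√n * ‖x‖`, and each coordinate is
a standard Gaussian. -/
lemma gaussianAbsMoment_mul_sqrt_finrank_le :
    gaussianAbsMoment * √(Module.finrank ℝ E) ≤ ∫ x, ‖x‖ ∂(stdGaussian E) := by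
  set n := Module.finrank ℝ E
  rcases Nat.eq_zero_or_pos n with hn | hn
  · rw [hn]
    simpa using integral_nonneg fun x : E ↦ norm_nonneg x
  set b := stdOrthonormalBasis ℝ E
  have hL : ∀ i, ∫ x, |innerSL ℝ (b i) x| ∂(stdGaussian E) = gaussianAbsMoment := by
    intro i
    have h := IsGaussian.map_eq_gaussianReal (μ := stdGaussian E) (innerSL ℝ (b i))
    rw [integral_strongDual_stdGaussian, variance_dual_stdGaussian, innerSL_apply_norm,
      b.norm_eq_one] at h
    rw [gaussianAbsMoment]
    have h1 : ((1 : ℝ) ^ 2).toNNReal = 1 := by simp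
    rw [h1] at h
    rw [← h, integral_map (by fun_prop) (by fun_prop)]
  have hint : ∀ i, Integrable (fun x ↦ |innerSL ℝ (b i) x|) (stdGaussian E) := fun i ↦
    (IsGaussian.integrable_dual (stdGaussian E) (innerSL ℝ (b i))).abs
  have hpt : ∀ x : E, ∑ i, |innerSL ℝ (b i) x| ≤ √n * ‖x‖ := by
    intro x
    have h := sq_sum_le_card_mul_sum_sq (s := Finset.univ) (f := fun i ↦ |innerSL ℝ (b i) x|)
    refine abs_le_of_sq_le_sq' ?_ (by positivity) |>.2
    rw [mul_pow, Real.sq_sqrt (by positivity)]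
    refine h.trans (le_of_eq ?_)
    rw [Finset.card_univ, Fintype.card_fin]
    congr 1
    have := b.sum_sq_norm_inner_right x
    simpa using this
  have h1 : (n : ℝ) * gaussianAbsMoment ≤ √n * ∫ x, ‖x‖ ∂(stdGaussian E) := by
    calc (n : ℝ) * gaussianAbsMoment = ∫ x, ∑ i, |innerSL ℝ (b i) x| ∂(stdGaussian E) := by
          rw [integral_finsetSum _ fun i _ ↦ hint i]
          rw [Finset.sum_congr rfl fun i _ ↦ hL i]
          simp [n]
      _ ≤ ∫ x, √n * ‖x‖ ∂(stdGaussian E) :=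
          integral_mono (integrable_finsetSum _ fun i _ ↦ hint i)
            (IsGaussian.integrable_id.norm.const_mul _) hpt
      _ = _ := integral_const_mul _ _
  have hs : 0 < √(n : ℝ) := by positivity
  have hss : √(n : ℝ) * √n = n := Real.mul_self_sqrt (by positivity)
  refine le_of_mul_le_mul_left ?_ hs
  calc √(n : ℝ) * (gaussianAbsMoment * √n) = (√(n : ℝ) * √n) * gaussianAbsMoment := by ring
    _ = n * gaussianAbsMoment := by rw [hss]
    _ ≤ _ := h1

end GaussianNorm

/-! ### Concentration on the sphere. -/

section SphereConcentration

open Metric Filter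

variable {E : Type*} [NormedAddCommGroup E] [InnerProductSpace ℝ E] [FiniteDimensional ℝ E]
  [MeasurableSpace E] [BorelSpace E]

lemma LipschitzWith.integrable_exp_stdGaussian {F : E → ℝ} {L : ℝ≥0} (hF : LipschitzWith L F)
    (t : ℝ) : Integrable (fun x ↦ Real.exp (t * F x)) (stdGaussian E) := by
  have hFc := hF.continuous
  refine ((integrable_exp_mul_norm_stdGaussian (E := E) (|t| * L)).const_mul
    (Real.exp (|t| * |F 0|))).mono' (by fun_prop) (Eventually.of_forall fun x ↦ ?_)
  rw [Real.norm_eq_abs, Real.abs_exp, ← Real.exp_add, Real.exp_le_exp]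
  have h1 := hF.dist_le_mul x 0
  rw [Real.dist_eq, dist_zero_right] at h1
  have h2 : |F x| ≤ |F 0| + L * ‖x‖ := by
    have := abs_sub_abs_le_abs_sub (F x) (F 0)
    linarith
  calc t * F x ≤ |t| * |F x| := by rw [← abs_mul]; exact le_abs_self _
    _ ≤ |t| * (|F 0| + L * ‖x‖) := by gcongr
    _ = _ := by ring

lemma LipschitzWith.integrable_stdGaussian {F : E → ℝ} {L : ℝ≥0} (hF : LipschitzWith L F) :
    Integrable F (stdGaussian E) := by
  have hFc := hF.continuous
  refine ((integrable_const (|F 0|)).add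
    ((IsGaussian.integrable_id (μ := stdGaussian E)).norm.const_mul (L : ℝ))).mono'
    (by fun_prop) (Eventually.of_forall fun x ↦ ?_)
  have h1 := hF.dist_le_mul x 0
  rw [Real.dist_eq, dist_zero_right] at h1
  have := abs_sub_abs_le_abs_sub (F x) (F 0)
  simp only [Real.norm_eq_abs, Pi.add_apply, id_eq]
  linarith

/-- Centered Lipschitz functions of a standard Gaussian vector are subgaussian. -/
theorem LipschitzWith.integral_exp_stdGaussian_le {F : E → ℝ} {L : ℝ≥0} (hF : LipschitzWith L F)
    (h0 : ∫ x, F x ∂(stdGaussian E) = 0) (t : ℝ) :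
    ∫ x, Real.exp (t * F x) ∂(stdGaussian E) ≤ Real.exp (Real.pi ^ 2 * L ^ 2 * t ^ 2 / 8) := by
  have h1 := hF.integral_exp_sub_stdGaussian_le t
  have h2 : ∀ p : E × E, Real.exp (t * (F p.2 - F p.1)) =
      Real.exp (-t * F p.1) * Real.exp (t * F p.2) := by
    intro p
    rw [← Real.exp_add]
    ring_nf
  simp_rw [h2] at h1
  rw [integral_prod_mul (fun x ↦ Real.exp (-t * F x)) (fun x ↦ Real.exp (t * F x))] at h1
  -- By Jensen and centering the factor of the independent copy is at least `1` and can be dropped.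
  have h3 : 1 ≤ ∫ x, Real.exp (-t * F x) ∂(stdGaussian E) := by
    have := exp_integral_le_integral_exp (hF.integrable_stdGaussian.const_mul (-t))
      (hF.integrable_exp_stdGaussian (-t))
    rwa [integral_const_mul, h0, mul_zero, Real.exp_zero] at this
  have h4 : 0 ≤ ∫ x, Real.exp (t * F x) ∂(stdGaussian E) :=
    integral_nonneg fun x ↦ (Real.exp_pos _).le
  nlinarith

lemma abs_sub_le_two_of_lipschitzWith {E : Type*} [NormedAddCommGroup E] [NormedSpace ℝ E]
    {f : E → ℝ} (hf : LipschitzWith 1 f) {x y : E} (hx : ‖x‖ ≤ 1) (hy : ‖y‖ ≤ 1) :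
    |f x - f y| ≤ 2 := by
  have := hf.dist_le_mul x y
  rw [Real.dist_eq, dist_eq_norm, NNReal.coe_one, one_mul] at this
  linarith [norm_sub_le x y]

/-- **Concentration on the sphere**: centered Lipschitz functions on the unit sphere are subgaussian
with variance proxy of the order of the inverse of the dimension. -/
theorem integral_exp_unifSphere_le [Nontrivial E] {f : E → ℝ} (hf : LipschitzWith 1 f)
    (h0 : ∫ θ, f (θ : sphere (0 : E) 1) ∂(unifSphere E) = 0) (t : ℝ) :
    ∫ θ, Real.exp (t * f (θ : sphere (0 : E) 1)) ∂(unifSphere E) ≤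
      Real.exp (2 * Real.pi ^ 2 / gaussianAbsMoment ^ 2 * t ^ 2 / Module.finrank ℝ E) := by
  have hfc := hf.continuous
  set γ := stdGaussian E
  set ρ := γ.map norm with hρ
  have : IsProbabilityMeasure ρ := Measure.isProbabilityMeasure_map measurable_norm.aemeasurable
  have hpolar : γ = ((unifSphere E).prod ρ).map (fun p ↦ p.2 • (p.1 : E)) :=
    eq_map_smul_of_withDensity_norm (P := γ)
      (w := fun r ↦ ENNReal.ofReal ((2 * Real.pi) ^ (-(Module.finrank ℝ E / 2 : ℝ)) *
        Real.exp (-(1 / 2) * r ^ 2))) (by fun_prop) stdGaussian_eq_withDensity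
  have hfint : Integrable (fun θ : sphere (0 : E) 1 ↦ f θ) (unifSphere E) := by
    refine Integrable.of_bound (C := |f 0| + 2) (by fun_prop) (Eventually.of_forall fun θ ↦ ?_)
    have h1 := abs_sub_le_two_of_lipschitzWith hf (x := (θ : E)) (y := 0) (by simp) (by simp)
    have h2 := abs_sub_abs_le_abs_sub (f θ) (f 0)
    rw [Real.norm_eq_abs]
    linarith
  have hfb : ∀ x : E, ‖x‖ = 1 → |f x| ≤ 2 := by
    intro x hx
    exact abs_le_of_integral_eq_zero hfint h0 (fun x y ↦
      abs_sub_le_two_of_lipschitzWith hf (by simp) (by simp)) ⟨x, by simpa using hx⟩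
  set H := homogeneousExtension f
  have hH : LipschitzWith 4 H := lipschitzWith_homogeneousExtension hf hfb
  have hHc := hH.continuous
  have hρ0 : ∀ᵐ p ∂((unifSphere E).prod ρ), 0 ≤ p.2 := by
    have : ∀ᵐ r ∂ρ, 0 ≤ r := by
      rw [hρ, ae_map_iff measurable_norm.aemeasurable measurableSet_Ici]
      exact Eventually.of_forall fun x ↦ norm_nonneg x
    exact Measure.quasiMeasurePreserving_snd.ae this
  have hHp : ∀ᵐ p ∂((unifSphere E).prod ρ), H (p.2 • (p.1 : E)) = p.2 * f p.1 := by
    filter_upwards [hρ0] with p hp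
    exact homogeneousExtension_smul f hp (by simp)
  have hφ : Measurable (fun p : sphere (0 : E) 1 × ℝ ↦ p.2 • (p.1 : E)) := by fun_prop
  set m := ∫ r, r ∂ρ with hm
  have hm' : m = ∫ x, ‖x‖ ∂γ := integral_map measurable_norm.aemeasurable (by fun_prop)
  have hρint : Integrable (fun r : ℝ ↦ r) ρ := by
    rw [hρ, integrable_map_measure (by fun_prop) measurable_norm.aemeasurable]
    exact IsGaussian.integrable_id.norm
  have hH0 : ∫ x, H x ∂γ = 0 := by
    rw [hpolar, integral_map hφ.aemeasurable (by fun_prop), integral_congr_ae hHp]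
    simp_rw [mul_comm _ (f _)]
    rw [integral_prod_mul (fun θ : sphere (0 : E) 1 ↦ f θ) (fun r : ℝ ↦ r), h0, zero_mul]
  have key : ∀ s : ℝ, ∫ θ, Real.exp (s * m * f (θ : sphere (0 : E) 1)) ∂(unifSphere E) ≤
      Real.exp (2 * Real.pi ^ 2 * s ^ 2) := by
    intro s
    have h1 := hH.integral_exp_stdGaussian_le hH0 s
    have h2 : Integrable (fun p : sphere (0 : E) 1 × ℝ ↦ Real.exp (s * (p.2 * f p.1)))
        ((unifSphere E).prod ρ) := by
      have := hH.integrable_exp_stdGaussian s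
      change Integrable _ γ at this
      rw [hpolar, integrable_map_measure (by fun_prop) hφ.aemeasurable] at this
      refine this.congr ?_
      filter_upwards [hHp] with p hp
      simp [hp]
    have h3 : ∫ x, Real.exp (s * H x) ∂γ =
        ∫ θ : sphere (0 : E) 1, ∫ r, Real.exp (s * (r * f θ)) ∂ρ ∂(unifSphere E) := by
      rw [hpolar, integral_map hφ.aemeasurable (by fun_prop), ← integral_prod _ h2]
      refine integral_congr_ae ?_
      filter_upwards [hHp] with p hp
      simp [hp]
    -- Jensen in the radius, for fixed direction, replaces `r` by its mean `m`.
    have h4 : ∫ θ, Real.exp (s * m * f (θ : sphere (0 : E) 1)) ∂(unifSphere E) ≤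
        ∫ θ : sphere (0 : E) 1, ∫ r, Real.exp (s * (r * f θ)) ∂ρ ∂(unifSphere E) := by
      refine integral_mono_of_nonneg (Eventually.of_forall fun θ ↦ (Real.exp_pos _).le)
        h2.integral_prod_left ?_
      filter_upwards [h2.prod_right_ae] with θ hθ
      have := exp_integral_le_integral_exp ((hρint.mul_const (f θ)).const_mul s) hθ
      rw [integral_const_mul, integral_mul_const, ← hm] at this
      simpa only [mul_assoc] using this
    rw [h3] at h1
    refine (h4.trans h1).trans (le_of_eq ?_)
    congr 1
    simp
    ring
  set n := Module.finrank ℝ E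
  have hn : (0 : ℝ) < n := by exact_mod_cast Module.finrank_pos
  have hκ := gaussianAbsMoment_pos
  have hmn : gaussianAbsMoment * √n ≤ m := hm' ▸ gaussianAbsMoment_mul_sqrt_finrank_le
  have hm0 : 0 < m := lt_of_lt_of_le (by positivity) hmn
  have hmn2 : gaussianAbsMoment ^ 2 * n ≤ m ^ 2 := by
    have := pow_le_pow_left₀ (by positivity) hmn 2
    rwa [mul_pow, Real.sq_sqrt hn.le] at this
  -- Rescaling by `m`, with `m ^ 2` at least of order `n`, produces the factor `1 / n`.
  have h := key (t / m)
  rw [div_mul_cancel₀ _ hm0.ne'] at h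
  refine h.trans (Real.exp_le_exp.2 ?_)
  calc 2 * Real.pi ^ 2 * (t / m) ^ 2 = 2 * Real.pi ^ 2 * t ^ 2 / m ^ 2 := by ring
    _ ≤ 2 * Real.pi ^ 2 * t ^ 2 / (gaussianAbsMoment ^ 2 * n) := by gcongr
    _ = _ := by field_simp

end SphereConcentration

/-! ### From large `t` to all `t` for centered variables. -/

section ScalarInequality

/-- A quadratic upper bound for the exponential remainder which is uniform in `x`. -/
lemma exp_mul_le_of_abs_le_one {t : ℝ} (ht : |t| ≤ 1) (x : ℝ) :
    Real.exp (t * x) ≤ 1 + t * x + t ^ 2 * (Real.exp x + Real.exp (-x) - 2) := by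
  have hs : ∀ y : ℝ, HasSum (fun k : ℕ ↦ y ^ (k + 2) / (k + 2).factorial)
      (Real.exp y - (1 + y)) := by
    intro y
    have h : HasSum (fun k : ℕ ↦ y ^ k / k.factorial) (Real.exp y) := by
      rw [Real.exp_eq_exp_ℝ]
      exact NormedSpace.expSeries_div_hasSum_exp y
    have h2 := (hasSum_nat_add_iff' 2).2 h
    simpa [Finset.sum_range_succ] using h2
  -- Termwise comparison of the power series from degree two on, using `|t| ^ (k + 2) ≤ t ^ 2`.
  have h1 : Real.exp (t * x) - (1 + t * x) ≤ t ^ 2 * (Real.exp |x| - (1 + |x|)) := by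
    refine hasSum_le (fun k ↦ ?_) (hs (t * x)) ((hs |x|).mul_left (t ^ 2))
    rw [← mul_div_assoc]
    gcongr
    calc (t * x) ^ (k + 2) ≤ |(t * x) ^ (k + 2)| := le_abs_self _
      _ = |t| ^ k * (t ^ 2 * |x| ^ (k + 2)) := by
        rw [abs_pow, abs_mul, mul_pow, pow_add |t|, sq_abs]; ring
      _ ≤ 1 * (t ^ 2 * |x| ^ (k + 2)) := by
        gcongr
        exact pow_le_one₀ (abs_nonneg t) ht
      _ = _ := one_mul _
  have h2 : Real.exp |x| - (1 + |x|) ≤ Real.exp x + Real.exp (-x) - 2 := by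
    rcases abs_cases x with ⟨h, _⟩ | ⟨h, _⟩
    · rw [h]; linarith [Real.add_one_le_exp (-x)]
    · rw [h]; linarith [Real.add_one_le_exp x]
  nlinarith [mul_le_mul_of_nonneg_left h2 (sq_nonneg t)]

/-- A bound on the moment generating function of a centered random variable by
`exp (a (|t| + t²))` improves to a subgaussian bound. -/
lemma integral_exp_mul_le_of_integral_eq_zero {Ω : Type*} [MeasurableSpace Ω] {μ : Measure Ω}
    [IsProbabilityMeasure μ] {X : Ω → ℝ} {A δ : ℝ} (hA : 0 ≤ A) (hδ : 0 ≤ δ) (hδ1 : δ ≤ 1)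
    (hX : Integrable X μ) (h0 : ∫ ω, X ω ∂μ = 0)
    (hexp : ∀ t : ℝ, Integrable (fun ω ↦ Real.exp (t * X ω)) μ)
    (hle : ∀ t : ℝ, 1 ≤ |t| → ∫ ω, Real.exp (t * X ω) ∂μ ≤ Real.exp (A * t ^ 2 * δ)) (t : ℝ) :
    ∫ ω, Real.exp (t * X ω) ∂μ ≤ Real.exp (2 * A * Real.exp A * t ^ 2 * δ) := by
  have hAe : A ≤ A * Real.exp A := le_mul_of_one_le_right hA (Real.one_le_exp hA)
  rcases le_total 1 |t| with ht | ht
  · refine (hle t ht).trans (Real.exp_le_exp.2 ?_)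
    gcongr
    nlinarith
  -- For `|t| ≤ 1` only the bounds at `1` and `-1` enter, and `h0` kills the linear term.
  have h1 := hexp 1
  have h2 := hexp (-1)
  have hl1 := hle 1 (by simp)
  have hl2 := hle (-1) (by simp)
  simp only [one_mul, neg_mul, one_pow, mul_one, even_two, Even.neg_pow] at h1 h2 hl1 hl2
  have hi1 : Integrable (fun ω ↦ 1 + t * X ω) μ := (integrable_const _).add (hX.const_mul t)
  have hi2 : Integrable (fun ω ↦ Real.exp (X ω) + Real.exp (-X ω)) μ := h1.add h2
  have hi3 : Integrable (fun ω ↦ t ^ 2 * (Real.exp (X ω) + Real.exp (-X ω) - 2)) μ :=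
    (hi2.sub (integrable_const _)).const_mul _
  have hmain : ∫ ω, Real.exp (t * X ω) ∂μ ≤ 1 + t ^ 2 * (2 * (Real.exp (A * δ) - 1)) := by
    calc ∫ ω, Real.exp (t * X ω) ∂μ
        ≤ ∫ ω, (1 + t * X ω + t ^ 2 * (Real.exp (X ω) + Real.exp (-X ω) - 2)) ∂μ :=
          integral_mono (hexp t) (hi1.add hi3) fun ω ↦ exp_mul_le_of_abs_le_one ht _
      _ = 1 + t ^ 2 * (∫ ω, Real.exp (X ω) ∂μ + ∫ ω, Real.exp (-X ω) ∂μ - 2) := by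
          rw [integral_add hi1 hi3, integral_add (integrable_const _) (hX.const_mul t),
            integral_const_mul, integral_const_mul, h0, integral_sub hi2 (integrable_const _),
            integral_add h1 h2]
          simp
      _ ≤ _ := by
          gcongr
          linarith
  have hexpA : Real.exp (A * δ) - 1 ≤ A * δ * Real.exp A := by
    have h3 := Real.add_one_le_exp (-(A * δ))
    have h4 : Real.exp (A * δ) * Real.exp (-(A * δ)) = 1 := by rw [← Real.exp_add]; simp
    have h5 : Real.exp (A * δ) ≤ Real.exp A := Real.exp_le_exp.2 (by nlinarith)
    have h6 : 0 < Real.exp (A * δ) := Real.exp_pos _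
    have h7 : 0 ≤ A * δ := by positivity
    nlinarith [mul_le_mul_of_nonneg_left h3 h6.le, mul_le_mul_of_nonneg_left h5 h7]
  calc ∫ ω, Real.exp (t * X ω) ∂μ ≤ 1 + t ^ 2 * (2 * (Real.exp (A * δ) - 1)) := hmain
    _ ≤ 1 + t ^ 2 * (2 * (A * δ * Real.exp A)) := by gcongr
    _ = 2 * A * Real.exp A * t ^ 2 * δ + 1 := by ring
    _ ≤ _ := Real.add_one_le_exp _

end ScalarInequality

/-! ### Combining direction and radius. -/

section Radial

open Metric Filter

variable {E : Type*} [NormedAddCommGroup E] [InnerProductSpace ℝ E] [FiniteDimensional ℝ E]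
  [MeasurableSpace E] [BorelSpace E]

/-- The constant in the moment generating function bound for radial measures. -/
noncomputable def radialConst : ℝ := 2 * Real.pi ^ 2 / gaussianAbsMoment ^ 2 + 8

lemma radialConst_pos : 0 < radialConst := by
  rw [radialConst]; positivity

lemma integrable_comp_of_norm_le_one {ν : Measure E} [IsProbabilityMeasure ν]
    (hν : ∀ᵐ x ∂ν, ‖x‖ ≤ 1) {G : E → ℝ} (hG : Continuous G) : Integrable G ν := by
  obtain ⟨C, hC⟩ := (isCompact_closedBall (0 : E) 1).exists_bound_of_continuousOn hG.continuousOn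
  refine Integrable.of_bound (C := C) (by fun_prop) ?_
  filter_upwards [hν] with x hx
  exact hC x (by simpa using hx)

/-- Lipschitz functions are subgaussian for the law of `R • θ` with `θ` uniform on the sphere and
`R` independent of `θ`, provided that `1 - R` is of the order of the inverse of the dimension. -/
theorem integral_exp_radial_le [Nontrivial E] {ν : Measure E} {ρ : Measure ℝ}
    [IsProbabilityMeasure ρ] (hν : ν = ((unifSphere E).prod ρ).map (fun p ↦ p.2 • (p.1 : E)))
    (hρ : ∀ᵐ r ∂ρ, 0 ≤ r ∧ r ≤ 1)
    (hρexp : ∀ a : ℝ, 0 ≤ a → ∫ r, Real.exp (a * (1 - r)) ∂ρ ≤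
      Real.exp ((2 * a + 2 * a ^ 2) / Module.finrank ℝ E))
    {F : E → ℝ} (hF : LipschitzWith 1 F) (h0 : ∫ x, F x ∂ν = 0) (t : ℝ) :
    ∫ x, Real.exp (t * F x) ∂ν ≤
      Real.exp (2 * radialConst * Real.exp radialConst * t ^ 2 * (1 / Module.finrank ℝ E)) := by
  have hFc := hF.continuous
  set n := Module.finrank ℝ E with hn
  have hn0 : 0 < n := Module.finrank_pos
  have hn' : (0 : ℝ) < n := by exact_mod_cast hn0
  have hn1 : (1 : ℝ) ≤ n := by exact_mod_cast hn0
  set φ : sphere (0 : E) 1 × ℝ → E := fun p ↦ p.2 • (p.1 : E) with hφdef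
  have hφ : Measurable φ := by fun_prop
  have hνprob : IsProbabilityMeasure ν := by
    rw [hν]; exact Measure.isProbabilityMeasure_map hφ.aemeasurable
  have hρ2 : ∀ᵐ p ∂((unifSphere E).prod ρ), 0 ≤ p.2 ∧ p.2 ≤ 1 :=
    Measure.quasiMeasurePreserving_snd.ae hρ
  have hφ1 : ∀ᵐ p ∂((unifSphere E).prod ρ), ‖φ p‖ ≤ 1 := by
    filter_upwards [hρ2] with p hp
    simp [hφdef, norm_smul, abs_of_nonneg hp.1, hp.2]
  have hν1 : ∀ᵐ x ∂ν, ‖x‖ ≤ 1 := by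
    rw [hν, ae_map_iff hφ.aemeasurable (measurableSet_le measurable_norm measurable_const)]
    exact hφ1
  have hσint : ∀ G : E → ℝ, Continuous G →
      Integrable (fun θ : sphere (0 : E) 1 ↦ G θ) (unifSphere E) := by
    intro G hG
    obtain ⟨C, hC⟩ := (isCompact_sphere (0 : E) 1).exists_bound_of_continuousOn hG.continuousOn
    exact Integrable.of_bound (C := C) (by fun_prop) (Eventually.of_forall fun θ ↦ hC θ θ.2)
  have hρint : ∀ g : ℝ → ℝ, Continuous g → Integrable g ρ := by
    intro g hg
    obtain ⟨C, hC⟩ := (isCompact_Icc (a := (0 : ℝ)) (b := 1)).exists_bound_of_continuousOn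
      hg.continuousOn
    refine Integrable.of_bound (C := C) (by fun_prop) ?_
    filter_upwards [hρ] with r hr using hC r hr
  have hφint : ∀ G : E → ℝ, Continuous G →
      Integrable (fun p ↦ G (φ p)) ((unifSphere E).prod ρ) := by
    intro G hG
    have := integrable_comp_of_norm_le_one hν1 hG
    rwa [hν, integrable_map_measure (by fun_prop) hφ.aemeasurable] at this
  set m := ∫ θ, F (θ : sphere (0 : E) 1) ∂(unifSphere E) with hm
  have hdist : ∀ᵐ p ∂((unifSphere E).prod ρ), |F (φ p) - F p.1| ≤ 1 - p.2 := by
    filter_upwards [hρ2] with p hp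
    have h1 := hF.dist_le_mul (φ p) p.1
    have h2 : φ p - p.1 = (p.2 - 1) • (p.1 : E) := by simp only [hφdef]; module
    rw [Real.dist_eq, dist_eq_norm, NNReal.coe_one, one_mul, h2, norm_smul, Real.norm_eq_abs,
      norm_eq_of_mem_sphere, mul_one, abs_of_nonpos (a := p.2 - 1) (by linarith [hp.2])] at h1
    linarith
  -- Jensen applied to `hρexp` at `a = 1`, where the exponent is `4 / n`.
  have hs1 : ∫ r, (1 - r) ∂ρ ≤ 4 / n := by
    have h1 := exp_integral_le_integral_exp (hρint (fun r ↦ 1 * (1 - r)) (by fun_prop))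
      (hρint _ (by fun_prop))
    have h2 := Real.exp_le_exp.1 (h1.trans (hρexp 1 zero_le_one))
    simp only [one_mul, mul_one, one_pow] at h2
    norm_num at h2 ⊢
    exact h2
  -- `F` is centered under `ν`, not on the sphere; the two means differ by at most the mean of `1 -
  -- r`.
  have hm4 : |m| ≤ 4 / n := by
    have h1 : ∫ p, F (φ p) ∂((unifSphere E).prod ρ) = 0 := by
      rw [← h0, hν, integral_map hφ.aemeasurable (by fun_prop)]
    have hF1 : Integrable (fun p : sphere (0 : E) 1 × ℝ ↦ F p.1) ((unifSphere E).prod ρ) :=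
      (hσint F hFc).comp_fst ρ
    have h2 : ∫ p, F (p.1 : sphere (0 : E) 1) ∂((unifSphere E).prod ρ) = m := by
      rw [integral_fun_fst (fun θ : sphere (0 : E) 1 ↦ F θ)]; simp [hm]
    have h3 : ∫ p, (1 - p.2) ∂((unifSphere E).prod ρ) = ∫ r, (1 - r) ∂ρ := by
      rw [integral_fun_snd (fun r : ℝ ↦ 1 - r)]; simp
    have h4 : -m = ∫ p, (F (φ p) - F p.1) ∂((unifSphere E).prod ρ) := by
      rw [integral_sub (hφint F hFc) hF1, h1, h2, zero_sub]
    rw [← abs_neg, h4, ← Real.norm_eq_abs]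
    refine (norm_integral_le_of_norm_le ((hρint (fun r ↦ 1 - r) (by fun_prop)).comp_snd _)
      hdist).trans ?_
    rw [h3]
    exact hs1
  refine integral_exp_mul_le_of_integral_eq_zero radialConst_pos.le (by positivity)
    (by rw [div_le_one hn']; exact hn1)
    (integrable_comp_of_norm_le_one hν1 hFc) h0
    (fun s ↦ integrable_comp_of_norm_le_one hν1 (by fun_prop)) (fun s hs ↦ ?_) t
  have hsphere := integral_exp_unifSphere_le (f := fun x ↦ F x - m)
    (by simpa using hF.sub (LipschitzWith.const m))
    (by rw [integral_sub (hσint F hFc) (integrable_const _)]; simp [hm]) s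
  rw [hν, integral_map hφ.aemeasurable (by fun_prop)]
  have hprod : Integrable (fun p : sphere (0 : E) 1 × ℝ ↦ Real.exp (s * (F p.1 - m)) *
      Real.exp (|s| * (1 - p.2))) ((unifSphere E).prod ρ) :=
    (hσint (fun x ↦ Real.exp (s * (F x - m))) (by fun_prop)).mul_prod
      (hρint (fun r ↦ Real.exp (|s| * (1 - r))) (by fun_prop))
  -- The exponent splits into the sphere mean, the centered value at the direction, and the radial
  -- displacement; independence factors the last two.
  calc ∫ p, Real.exp (s * F (φ p)) ∂((unifSphere E).prod ρ)
      ≤ ∫ p, Real.exp (s * m) * (Real.exp (s * (F p.1 - m)) * Real.exp (|s| * (1 - p.2)))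
          ∂((unifSphere E).prod ρ) := by
        refine integral_mono_ae (hφint (fun x ↦ Real.exp (s * F x)) (by fun_prop))
          (hprod.const_mul _) ?_
        filter_upwards [hdist] with p hp
        rw [← Real.exp_add, ← Real.exp_add, Real.exp_le_exp]
        have h1 : s * (F (φ p) - F p.1) ≤ |s| * (1 - p.2) := by
          refine (le_abs_self _).trans ?_
          rw [abs_mul]
          gcongr
        linarith
    _ = Real.exp (s * m) * ((∫ θ, Real.exp (s * (F (θ : sphere (0 : E) 1) - m)) ∂(unifSphere E)) *
          ∫ r, Real.exp (|s| * (1 - r)) ∂ρ) := by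
        rw [integral_const_mul, integral_prod_mul
          (fun θ : sphere (0 : E) 1 ↦ Real.exp (s * (F θ - m)))
          (fun r ↦ Real.exp (|s| * (1 - r)))]
    _ ≤ Real.exp (|s| * (4 / n)) *
          (Real.exp (2 * Real.pi ^ 2 / gaussianAbsMoment ^ 2 * s ^ 2 / n) *
          Real.exp ((2 * |s| + 2 * |s| ^ 2) / n)) := by
        have h1 : s * m ≤ |s| * (4 / n) := by
          refine (le_abs_self _).trans ?_
          rw [abs_mul]
          gcongr
        have h2 := hρexp |s| (abs_nonneg s)
        have h3 : 0 ≤ ∫ r, Real.exp (|s| * (1 - r)) ∂ρ :=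
          integral_nonneg fun r ↦ (Real.exp_pos _).le
        gcongr
    _ = Real.exp ((2 * Real.pi ^ 2 / gaussianAbsMoment ^ 2 * s ^ 2 + 6 * |s| + 2 * s ^ 2) / n) := by
        rw [← Real.exp_add, ← Real.exp_add, sq_abs]
        congr 1
        ring
    _ ≤ Real.exp (radialConst * s ^ 2 * (1 / n)) := by
        -- Here `|s| ≥ 1` enters: `6 * |s| + 2 * s ^ 2 ≤ 8 * s ^ 2`, the origin of the `8` in
        -- `radialConst`.
        have h1 : |s| ≤ s ^ 2 := by rw [← sq_abs]; nlinarith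
        rw [Real.exp_le_exp, mul_one_div, radialConst]
        gcongr
        linarith

end Radial

/-! ### Exponential moments of the radial density. -/

section ShellRadius

open intervalIntegral

/-- Exponential moments of `1 - r` for the density proportional to `r ^ (n - 1)` on `[b, 1]`. -/
lemma intervalIntegral_pow_mul_exp_le {n : ℕ} (hn : 0 < n) {a b : ℝ} (ha : 0 ≤ a) (hb0 : 0 ≤ b)
    (hb1 : b ≤ 1) :
    (n - a) * ∫ r in b..1, r ^ (n - 1) * Real.exp (a * (1 - r)) ≤
      n * ∫ r in b..1, r ^ (n - 1) := by
  set J := ∫ r in b..1, r ^ (n - 1) * Real.exp (a * (1 - r)) with hJ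
  set J' := ∫ r in b..1, r ^ n * Real.exp (a * (1 - r)) with hJ'
  set I := ∫ r in b..1, r ^ (n - 1) with hI
  have hd : ∀ r : ℝ, HasDerivAt (fun r ↦ r ^ n * Real.exp (a * (1 - r)))
      (n * (r ^ (n - 1) * Real.exp (a * (1 - r))) - a * (r ^ n * Real.exp (a * (1 - r)))) r := by
    intro r
    have h1 : HasDerivAt (fun r : ℝ ↦ a * (1 - r)) (-a) r := by
      simpa using ((hasDerivAt_id r).const_sub 1).const_mul a
    refine ((hasDerivAt_pow n r).mul h1.exp).congr_deriv ?_
    ring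
  have hd' : ∀ r : ℝ, HasDerivAt (fun r : ℝ ↦ r ^ n) (n * r ^ (n - 1)) r := fun r ↦
    hasDerivAt_pow n r
  have hc1 : Continuous fun r : ℝ ↦ r ^ (n - 1) * Real.exp (a * (1 - r)) := by fun_prop
  have hc2 : Continuous fun r : ℝ ↦ r ^ n * Real.exp (a * (1 - r)) := by fun_prop
  have h1 : n * J - a * J' = 1 - b ^ n * Real.exp (a * (1 - b)) := by
    have := integral_eq_sub_of_hasDerivAt (a := b) (b := 1) (fun r _ ↦ hd r)
      (Continuous.intervalIntegrable (by fun_prop) _ _)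
    rw [integral_sub ((hc1.intervalIntegrable _ _).const_mul _)
      ((hc2.intervalIntegrable _ _).const_mul _), intervalIntegral.integral_const_mul, intervalIntegral.integral_const_mul] at this
    simpa using this
  have h2 : n * I = 1 - b ^ n := by
    have := integral_eq_sub_of_hasDerivAt (a := b) (b := 1) (fun r _ ↦ hd' r)
      (Continuous.intervalIntegrable (by fun_prop) _ _)
    rw [intervalIntegral.integral_const_mul] at this
    rw [this, one_pow]
  have h3 : J' ≤ J := by
    -- `r ^ n ≤ r ^ (n - 1)` on `[b, 1]` turns the integrated derivative into an inequality for `J`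
    -- alone.
    refine integral_mono_on hb1 (hc2.intervalIntegrable _ _) (hc1.intervalIntegrable _ _) ?_
    intro r hr
    have h4 : 0 ≤ r := hb0.trans hr.1
    gcongr ?_ * _
    exact pow_le_pow_of_le_one h4 hr.2 (by omega)
  -- The boundary term at `b` has the favourable sign, so the bound is uniform in the inner radius.
  have h5 : b ^ n ≤ b ^ n * Real.exp (a * (1 - b)) :=
    le_mul_of_one_le_right (by positivity) (Real.one_le_exp (mul_nonneg ha (by linarith)))
  nlinarith [mul_le_mul_of_nonneg_left h3 ha]

/-- If `2a ≤ n`, then `n / (n - a) ≤ 1 + 2a / n`; otherwise `a ≤ 2a² / n` and the crude bound `exp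
a` suffices. -/
lemma le_exp_of_sub_mul_le {n a X : ℝ} (hn : 0 < n) (ha : 0 ≤ a) (h1 : X ≤ Real.exp a)
    (h2 : (n - a) * X ≤ n) : X ≤ Real.exp ((2 * a + 2 * a ^ 2) / n) := by
  rcases le_total (2 * a) n with h | h
  · have h3 : X ≤ 2 * a / n + 1 := by
      by_contra! hX
      have h4 : (n - a) * (2 * a / n + 1) < (n - a) * X := by
        rcases eq_or_ne a 0 with rfl | ha'
        · nlinarith
        · have : 0 < a := lt_of_le_of_ne ha ha'.symm
          have : 0 < n - a := by linarith
          gcongr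
      have h5 : (n - a) * (2 * a / n + 1) = n + a * (n - 2 * a) / n := by
        field_simp; ring
      have h6 : 0 ≤ a * (n - 2 * a) / n := by
        have : 0 ≤ n - 2 * a := by linarith
        positivity
      linarith
    refine (h3.trans (Real.add_one_le_exp _)).trans (Real.exp_le_exp.2 ?_)
    gcongr
    nlinarith
  · refine h1.trans (Real.exp_le_exp.2 ?_)
    rw [le_div_iff₀ hn]
    nlinarith

end ShellRadius

/-! ### The uniform law on the shell. -/

section Shell

open Metric Filter

lemma measurableSet_shell (n : ℕ) (ε : ℝ) : MeasurableSet (shell n ε) :=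
  (measurableSet_le measurable_const measurable_norm).inter
    (measurableSet_le measurable_norm measurable_const)

lemma volume_shell_ne_top (n : ℕ) (ε : ℝ) : volume (shell n ε) ≠ ∞ := by
  refine ((measure_mono fun x hx ↦ ?_).trans_lt
    (measure_closedBall_lt_top (x := (0 : EuclideanSpace ℝ (Fin n))) (r := 1))).ne
  simpa using hx.2

lemma volume_shell_ne_zero {n : ℕ} (hn : 0 < n) {ε : ℝ} (h0 : 0 < ε) (h1 : ε ≤ 1) :
    volume (shell n ε) ≠ 0 := by
  have : Nonempty (Fin n) := ⟨⟨0, hn⟩⟩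
  have hopen : IsOpen {x : EuclideanSpace ℝ (Fin n) | 1 - ε < ‖x‖ ∧ ‖x‖ < 1} :=
    (isOpen_lt continuous_const continuous_norm).inter
      (isOpen_lt continuous_norm continuous_const)
  obtain ⟨v, hv⟩ := exists_norm_eq (EuclideanSpace ℝ (Fin n)) (c := 1 - ε / 2) (by linarith)
  have hne : {x : EuclideanSpace ℝ (Fin n) | 1 - ε < ‖x‖ ∧ ‖x‖ < 1}.Nonempty :=
    ⟨v, by constructor <;> rw [hv] <;> linarith⟩
  exact ((hopen.measure_pos volume hne).trans_le
    (measure_mono fun x (hx : _ < _ ∧ _ < _) ↦ And.intro hx.1.le hx.2.le)).ne'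

lemma setIntegral_shell_norm {n : ℕ} (hn : 0 < n) {ε : ℝ} (h0 : 0 ≤ ε) (h1 : ε ≤ 1) (g : ℝ → ℝ) :
    ∫ x in shell n ε, g ‖x‖ =
      (n * volume.real (ball (0 : EuclideanSpace ℝ (Fin n)) 1)) *
        ∫ r in (1 - ε)..1, r ^ (n - 1) * g r := by
  have : Nonempty (Fin n) := ⟨⟨0, hn⟩⟩
  have h := integral_fun_norm_addHaar (volume : Measure (EuclideanSpace ℝ (Fin n)))
    ((Icc (1 - ε) 1).indicator g)
  have h2 : ∀ x : EuclideanSpace ℝ (Fin n), (Icc (1 - ε) 1).indicator g ‖x‖ =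
      (shell n ε).indicator (fun x ↦ g ‖x‖) x := fun x ↦ rfl
  simp_rw [h2] at h
  rw [integral_indicator (measurableSet_shell n ε)] at h
  rw [h, finrank_euclideanSpace_fin, nsmul_eq_mul, smul_eq_mul, mul_assoc]
  congr 2
  rw [intervalIntegral.integral_of_le (by linarith)]
  have h3 : ∀ r : ℝ, r ^ (n - 1) • (Icc (1 - ε) 1).indicator g r =
      (Icc (1 - ε) 1).indicator (fun r ↦ r ^ (n - 1) * g r) r := by
    intro r
    by_cases hr : r ∈ Icc (1 - ε) 1 <;> simp [hr]
  simp_rw [h3]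
  rw [setIntegral_indicator measurableSet_Icc]
  -- The half-open interval avoids `0` even when `ε = 1`; the lost endpoint is null.
  refine setIntegral_congr_set ?_
  have h4 : (Ioi 0 ∩ Ioc (1 - ε) 1 : Set ℝ) = Ioc (1 - ε) 1 :=
    inter_eq_right.2 fun r hr ↦ lt_of_le_of_lt (by linarith) hr.1
  rw [← h4]
  exact (ae_eq_refl _).inter Ioc_ae_eq_Icc.symm

lemma integral_exp_one_sub_norm_shell_le {n : ℕ} (hn : 0 < n) {ε : ℝ} (h0 : 0 < ε) (h1 : ε ≤ 1)
    {a : ℝ} (ha : 0 ≤ a) :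
    ∫ x, Real.exp (a * (1 - ‖x‖)) ∂(ProbabilityTheory.cond volume (shell n ε)) ≤
      Real.exp ((2 * a + 2 * a ^ 2) / n) := by
  have hn' : (0 : ℝ) < n := by exact_mod_cast hn
  have hprob : IsProbabilityMeasure (ProbabilityTheory.cond volume (shell n ε)) :=
    cond_isProbabilityMeasure_of_finite (volume_shell_ne_zero hn h0 h1) (volume_shell_ne_top n ε)
  refine le_exp_of_sub_mul_le hn' ha ?_ ?_
  · have hle : ∀ x : EuclideanSpace ℝ (Fin n), Real.exp (a * (1 - ‖x‖)) ≤ Real.exp a := by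
      intro x
      rw [Real.exp_le_exp]
      nlinarith [norm_nonneg x]
    refine (integral_mono_of_nonneg (Eventually.of_forall fun x ↦ (Real.exp_pos _).le)
      (integrable_const _) (Eventually.of_forall hle)).trans ?_
    simp
  · set V := volume.real (shell n ε)
    have hV : 0 < V := ENNReal.toReal_pos (volume_shell_ne_zero hn h0 h1) (volume_shell_ne_top n ε)
    have hI := setIntegral_shell_norm hn h0.le h1 (fun _ ↦ 1)
    have hJ := setIntegral_shell_norm hn h0.le h1 (fun r ↦ Real.exp (a * (1 - r)))
    simp only [integral_const, MeasurableSet.univ, measureReal_restrict_apply, univ_inter,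
      smul_eq_mul, mul_one] at hI
    have hle := intervalIntegral_pow_mul_exp_le hn ha (b := 1 - ε) (by linarith) (by linarith)
    rw [ProbabilityTheory.cond, integral_smul_measure, hJ, ENNReal.toReal_inv, smul_eq_mul]
    change _ * (V⁻¹ * _) ≤ _
    change V = _ at hI
    set c := (n : ℝ) * volume.real (ball (0 : EuclideanSpace ℝ (Fin n)) 1)
    have hc : 0 ≤ c := by positivity
    have h2 := mul_le_mul_of_nonneg_left hle hc
    rw [← mul_le_mul_iff_right₀ hV]
    -- The polar factor `c` occurs in both the integral and the volume `V`, so it cancels.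
    calc V * ((n - a) * (V⁻¹ * (c * ∫ r in (1 - ε)..1, r ^ (n - 1) * Real.exp (a * (1 - r))))) =
        c * ((n - a) * ∫ r in (1 - ε)..1, r ^ (n - 1) * Real.exp (a * (1 - r))) := by
          field_simp
      _ ≤ c * (n * ∫ r in (1 - ε)..1, r ^ (n - 1)) := h2
      _ = V * n := by rw [hI]; ring

/-- The uniform distribution on the shell is the law of `R • θ` with `θ` uniform on the sphere and
`R` independent of `θ`, with `1 - R` of the order of `1 / n`. -/
lemma exists_uniformShell_eq_map_smul {n : ℕ} (hn : 0 < n) {ε : ℝ} (h0 : 0 ≤ ε) (h1 : ε ≤ 1) :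
    ∃ ρ : Measure ℝ, IsProbabilityMeasure ρ ∧
      uniformShell n ε = ((unifSphere (EuclideanSpace ℝ (Fin n))).prod ρ).map
        (fun p ↦ p.2 • (p.1 : EuclideanSpace ℝ (Fin n))) ∧
      (∀ᵐ r ∂ρ, 0 ≤ r ∧ 1 - ε ≤ r ∧ r ≤ 1) ∧
      ∀ a : ℝ, 0 ≤ a → ∫ r, Real.exp (a * (1 - r)) ∂ρ ≤ Real.exp ((2 * a + 2 * a ^ 2) / n) := by
  have : Nonempty (Fin n) := ⟨⟨0, hn⟩⟩
  rcases h0.eq_or_lt with rfl | h0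
  · refine ⟨Measure.dirac 1, inferInstance, ?_, ?_, fun a ha ↦ ?_⟩
    · rw [uniformShell, if_pos rfl, Measure.prod_dirac, Measure.map_map (by fun_prop) (by fun_prop),
        unifSphere]
      congr 1
      ext θ
      simp
    · rw [ae_dirac_iff (by measurability)]
      norm_num
    · rw [integral_dirac]
      simp only [sub_self, mul_zero, Real.exp_zero]
      exact Real.one_le_exp (by positivity)
  · have hV0 := volume_shell_ne_zero hn h0 h1
    have hVT := volume_shell_ne_top n ε
    set ν := ProbabilityTheory.cond volume (shell n ε) with hν
    have hprob : IsProbabilityMeasure ν := cond_isProbabilityMeasure_of_finite hV0 hVT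
    have hdens : ν = volume.withDensity (fun x ↦
        (Icc (1 - ε) 1).indicator (fun _ ↦ (volume (shell n ε))⁻¹) ‖x‖) := by
      have : (fun x : EuclideanSpace ℝ (Fin n) ↦
          (Icc (1 - ε) 1).indicator (fun _ ↦ (volume (shell n ε))⁻¹) ‖x‖) =
          (shell n ε).indicator (fun _ ↦ (volume (shell n ε))⁻¹) := rfl
      rw [this, withDensity_indicator (measurableSet_shell n ε), withDensity_const, hν,
        ProbabilityTheory.cond]
    refine ⟨ν.map norm, Measure.isProbabilityMeasure_map measurable_norm.aemeasurable, ?_, ?_, ?_⟩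
    · rw [uniformShell, if_neg h0.ne']
      exact eq_map_smul_of_withDensity_norm (P := ν)
        (w := (Icc (1 - ε) 1).indicator (fun _ ↦ (volume (shell n ε))⁻¹))
        (measurable_const.indicator measurableSet_Icc) hdens
    · rw [ae_map_iff measurable_norm.aemeasurable (by measurability)]
      filter_upwards [ae_cond_mem (measurableSet_shell n ε)] with x hx
      exact ⟨norm_nonneg x, hx.1, hx.2⟩
    · intro a ha
      rw [integral_map measurable_norm.aemeasurable (by fun_prop)]
      exact integral_exp_one_sub_norm_shell_le hn h0 h1 ha

/-- The radius lies almost surely in `[1 - ε, 1]`, so restricting to the subtype loses no mass;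
integrals can then be moved to the ambient space. -/
lemma map_val_shellMeasure {n : ℕ} (hn : 0 < n) {ε : ℝ} (h0 : 0 ≤ ε) (h1 : ε ≤ 1) :
    (shellMeasure n ε).map Subtype.val = uniformShell n ε := by
  have : Nonempty (Fin n) := ⟨⟨0, hn⟩⟩
  obtain ⟨ρ, hρ, hmap, hρ1, -⟩ := exists_uniformShell_eq_map_smul hn h0 h1
  rw [shellMeasure, (MeasurableEmbedding.subtype_coe (measurableSet_shell n ε)).map_comap,
    Subtype.range_coe]
  refine Measure.restrict_eq_self_of_ae_mem ?_
  rw [hmap]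
  refine (ae_map_iff (p := (· ∈ shell n ε)) (by fun_prop) (measurableSet_shell n ε)).2 ?_
  have h2 : ∀ᵐ p ∂((unifSphere (EuclideanSpace ℝ (Fin n))).prod ρ),
      0 ≤ p.2 ∧ 1 - ε ≤ p.2 ∧ p.2 ≤ 1 :=
    Measure.quasiMeasurePreserving_snd.ae hρ1
  filter_upwards [h2] with p hp
  have h3 : ‖p.2 • (p.1 : EuclideanSpace ℝ (Fin n))‖ = p.2 := by
    simp [norm_smul, abs_of_nonneg hp.1]
  exact ⟨hp.2.1.trans_eq h3.symm, h3.trans_le hp.2.2⟩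

end Shell

theorem corollary6p2 :
    ∃ c : ℝ, 0 < c ∧ ∀ n : ℕ, 2 ≤ n → ∀ ε : ℝ, 0 ≤ ε → ε ≤ 1 →
      subgaussianConst (shellMeasure n ε) ≤ ENNReal.ofReal (c / n) := by
  have hA := radialConst_pos
  -- Twice the constant in `integral_exp_radial_le`, since the subgaussian exponent carries a factor
  -- `1 / 2`.
  refine ⟨4 * radialConst * Real.exp radialConst, by positivity, fun n hn ε h0 h1 ↦ ?_⟩
  have hn0 : 0 < n := by omega
  have : Nonempty (Fin n) := ⟨⟨0, hn0⟩⟩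
  set c := 4 * radialConst * Real.exp radialConst with hc
  have hc0 : 0 ≤ c / n := by positivity
  refine iInf₂_le (Real.toNNReal (c / n)) fun f hf hfint hf0 ↦ ?_
  obtain ⟨ρ, hρ, hmap, hρ1, hρexp⟩ := exists_uniformShell_eq_map_smul hn0 h0 h1
  -- McShane extension: `f` is the restriction of a 1-Lipschitz function on the whole space.
  obtain ⟨F, hF, hFf⟩ : ∃ F : EuclideanSpace ℝ (Fin n) → ℝ, LipschitzWith 1 F ∧
      ∀ x : shell n ε, f x = F x := by
    have hext : (shell n ε).domRestrict (Function.extend Subtype.val f 0) = f := by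
      ext x
      exact Subtype.val_injective.extend_apply f 0 x
    obtain ⟨F, hF, hFeq⟩ := LipschitzOnWith.extend_real (K := 1) (s := shell n ε)
      (f := Function.extend Subtype.val f 0) (by rw [lipschitzOnWith_iff_restrict, hext]; exact hf)
    exact ⟨F, hF, fun x ↦ by
      rw [← hFeq x.2, Subtype.val_injective.extend_apply f 0 x]⟩
  have hFc := hF.continuous
  obtain rfl : f = fun x : shell n ε ↦ F x := funext (α := shell n ε) hFf
  have hval := map_val_shellMeasure hn0 h0 h1
  have hvm : AEMeasurable Subtype.val (shellMeasure n ε) := measurable_subtype_coe.aemeasurable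
  have hF0 : ∫ x, F x ∂(uniformShell n ε) = 0 := by
    rw [← hval, integral_map hvm (by fun_prop), hf0]
  have hprob : IsProbabilityMeasure (uniformShell n ε) := by
    rw [hmap]; exact Measure.isProbabilityMeasure_map (by fun_prop)
  have hprob' : IsProbabilityMeasure (shellMeasure n ε) :=
    (Measure.isProbabilityMeasure_map_iff hvm).1 (hval ▸ hprob)
  refine ⟨fun t ↦ ?_, fun t ↦ ?_⟩
  · have hb : ∀ x : shell n ε, |F x| ≤ 2 :=
      abs_le_of_integral_eq_zero hfint hf0 fun x y ↦
        abs_sub_le_two_of_lipschitzWith hF x.2.2 y.2.2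
    refine Integrable.of_bound (C := Real.exp (|t| * 2)) (by fun_prop)
      (Filter.Eventually.of_forall fun x ↦ ?_)
    rw [Real.norm_eq_abs, Real.abs_exp, Real.exp_le_exp]
    refine (le_abs_self _).trans ?_
    rw [abs_mul]
    gcongr
    exact hb x
  · have h := integral_exp_radial_le hmap (hρ1.mono fun r hr ↦ ⟨hr.1, hr.2.2⟩)
      (by simpa using hρexp) hF hF0 t
    rw [← hval, integral_map hvm (by fun_prop)] at h
    refine h.trans (Real.exp_le_exp.2 (le_of_eq ?_))
    rw [Real.coe_toNNReal _ hc0, finrank_euclideanSpace_fin, hc]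
    ring
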